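/- Let $(N,r)$ be one of $(1^*,6),(2,4),(3,3),(4,2)$ (with $1^*$ read as $1$ in formulas). Let $\mathcal M\subset\mathbb C$ be open and connected, let $\alpha:\mathcal M\to\mathbb C\setminus\{0,1\}$ be holomorphic with nowhere vanishing derivative, and put $\beta=1-\alpha$, $\partial_\alpha=(\alpha')^{-1}\frac{d}{ds}$, $\theta=\alpha\,\partial_\alpha$. (So $\alpha$ is a local coordinate on $\mathcal M$, and functions on $\mathcal M$ may be multivalued in $\alpha$.) Let $\tau:\mathcal M\to\mathbb H$ and $f:\mathcal M\to\mathbb C$ be holomorphic, and consider the family of elliptic curves $E_s=\mathbb C/(\mathbb Z+\mathbb Z\tau(s))$ with the holomorphic forms $\Omega_s=f(s)\,dz$. Let $$C_\alpha(s)=\int_{E_s}\Omega\wedge\partial_\alpha\Omega$$ be the Yukawa coupling, where $\partial_\alpha\Omega$ is the Gauss--Manin derivative, computed in the trivialization $\mathbb R^2/\mathbb Z^2\to E_s$, $(x,y)\mapsto x+y\tau(s)$. (1) Suppose that all the periods $\Pi$ of $\Omega$ over integral cycles satisfy the Picard--Fuchs equation $$\Bigl(\theta^2-\alpha(\theta+\tfrac1r)(\theta+1-\tfrac1r)\Bigr)\Pi=0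 .$$ Then there is a constant $c$ with $C_\alpha=\dfrac{c}{\alpha\beta}$ on $\mathcal M$. If moreover $\Omega$ is normalized at $\alpha=0$, that is, $0$ is in the closure of $\alpha(\mathcal M)$ and $\alpha C_\alpha\to1$ as $\alpha\to0$, then $$C_\alpha=\frac1{\alpha\beta}\quad\text{on }\mathcal M .$$ (2) Let $\omega_0(\alpha)={}_2F_1(\tfrac1r,1-\tfrac1r;1;\alpha)$ and $\omega_1(\alpha)=\frac{i}{\sqrt N}\,{}_2F_1(\tfrac1r,1-\tfrac1r;1;1-\alpha)$, and suppose that for some constant $\lambda\in\mathbb C$ one has $\tau=\omega_1/\omega_0$ and $\Omega=\lambda\,\omega_0\,dz$, in the sense that these equations hold near some point $s_0$ with $|\alpha(s_0)|<1$ and $|1-\alpha(s_0)|<1$ (and hence, by analytic continuation, on $\mathcal M$). Then the periods of $\Omega$ satisfy the Picard--Fuchs equation in (1), and $$C_\alpha=\frac{\lambda^2}{2\pi i}\cdot\frac1{\alpha\beta}\quad\text{on }\mathcal M .$$ In particular $C_\alpha=\dfrac1{\alpha\beta}$ when $\lambda^2=2\pi i$. -/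

import Mathlib

open Filter Topology

noncomputable section

/-- The four levels `N = 1*, 2, 3, 4` of the elliptic curve families over `X₀(N)`. -/
inductive ModularLevel where
  | one_star
  | two
  | three
  | four

namespace ModularLevel

/-- The integer `N` attached to a level (`1*` counts as `1`). -/
def N : ModularLevel → ℕ
  | one_star => 1
  | two => 2
  | three => 3
  | four => 4

/-- The integer `r = 6, 4, 3, 2` attached to `N = 1*, 2, 3, 4`. -/
def r : ModularLevel → ℕ
  | one_star => 6
  | two => 4
  | three => 3
  | four => 2

/-- The hypergeometric function `₂F₁(1/r, 1 - 1/r; 1; x)`, for `‖x‖ < 1`. -/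
def hyp (L : ModularLevel) (x : ℂ) : ℂ :=
  ordinaryHypergeometric (1 / (L.r : ℂ)) (1 - 1 / (L.r : ℂ)) 1 x

/-- The period `ω₀(α) = ₂F₁(1/r, 1 - 1/r; 1; α)`, for `‖α‖ < 1`. -/
def omega0 (L : ModularLevel) (a : ℂ) : ℂ := L.hyp a

/-- The period `ω₁(α) = (i / √N) ₂F₁(1/r, 1 - 1/r; 1; 1 - α)`, for `‖1 - α‖ < 1`. -/
def omega1 (L : ModularLevel) (a : ℂ) : ℂ :=
  Complex.I / ((Real.sqrt (L.N : ℝ) : ℝ) : ℂ) * L.hyp (1 - a)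

end ModularLevel

/-- A complex valued differential 1-form on the real plane. Those that are used below are
invariant under translations, hence are forms on the torus `ℝ² / ℤ²`. -/
abbrev PlaneOneForm := ℝ × ℝ → (ℝ × ℝ →L[ℝ] ℂ)

/-- The coefficient of `dx ∧ dy` in the wedge product of two 1-forms `η`, `ξ`. -/
def wedgeCoeff (η ξ : PlaneOneForm) (p : ℝ × ℝ) : ℂ :=
  η p (1, 0) * ξ p (0, 1) - η p (0, 1) * ξ p (1, 0)

/-- The integral of `η ∧ ξ` over the torus `ℝ² / ℤ²`, oriented by `dx ∧ dy`. -/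
def torusIntegralWedge (η ξ : PlaneOneForm) : ℂ :=
  ∫ x in (0 : ℝ)..1, ∫ y in (0 : ℝ)..1, wedgeCoeff η ξ (x, y)

/-- The integral of a 1-form along the closed curve `t ↦ (t m, t n)`, `0 ≤ t ≤ 1`, of the torus
`ℝ² / ℤ²`; these curves represent all the integral homology classes of degree one. -/
def torusPeriod (η : PlaneOneForm) (m n : ℤ) : ℂ :=
  ∫ t in (0 : ℝ)..1, η (t * m, t * n) ((m : ℝ), (n : ℝ))

/-- The real linear map `(x, y) ↦ x + y τ`. It induces an orientation preserving (for `0 < Im τ`)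
diffeomorphism from the torus `ℝ² / ℤ²` onto the elliptic curve `ℂ / (ℤ + ℤ τ)`. -/
def torusMarking (τ : ℂ) (p : ℝ × ℝ) : ℂ := (p.1 : ℂ) + (p.2 : ℂ) * τ

/-- The 1-form `c dz` on `ℂ`; it descends to `ℂ / (ℤ + ℤ τ)`, and every holomorphic 1-form on
this elliptic curve is of this kind. -/
def constDz (c : ℂ) : ℂ → (ℂ →L[ℝ] ℂ) := fun _ => c • ContinuousLinearMap.id ℝ ℂ

/-- The pull back of a 1-form on `ℂ` by a map from the plane. -/
def pullbackOneForm (φ : ℝ × ℝ → ℂ) (η : ℂ → (ℂ →L[ℝ] ℂ)) : PlaneOneForm :=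
  fun p => (η (φ p)).comp (fderiv ℝ φ p)

/-- A holomorphic family of elliptic curves `ℂ / (ℤ + ℤ τ(s))` over a connected open set `base`
of the complex plane, with a holomorphic family of holomorphic 1-forms `Ω_s = f(s) dz`, and with
a local coordinate `α` on the base, which has values in `ℂ ∖ {0, 1}`. The map `α` is locally, but
perhaps not globally, injective: the base may be a covering space of an open set of
`ℂ ∖ {0, 1}`, so that `τ` and `f` may be multivalued as functions of `α`. -/
structure EllipticFamily where
  base : Set ℂ
  isOpen_base : IsOpen base
  isConnected_base : IsConnected base
  α : ℂ → ℂ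
  differentiableOn_α : DifferentiableOn ℂ α base
  deriv_α_ne_zero : ∀ s ∈ base, deriv α s ≠ 0
  α_ne_zero : ∀ s ∈ base, α s ≠ 0
  α_ne_one : ∀ s ∈ base, α s ≠ 1
  τ : ℂ → ℂ
  differentiableOn_τ : DifferentiableOn ℂ τ base
  im_τ_pos : ∀ s ∈ base, 0 < (τ s).im
  f : ℂ → ℂ
  differentiableOn_f : DifferentiableOn ℂ f base

namespace EllipticFamily

variable (F : EllipticFamily)

/-- The derivative `∂_α = (dα/ds)⁻¹ d/ds` with respect to the coordinate `α`. -/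
def dα {E : Type} [NormedAddCommGroup E] [NormedSpace ℂ E] (g : ℂ → E) (s : ℂ) : E :=
  (deriv F.α s)⁻¹ • deriv g s

/-- The operator `θ + c = α ∂_α + c` on functions on the base. -/
def θadd (c : ℂ) (g : ℂ → ℂ) (s : ℂ) : ℂ := F.α s * F.dα g s + c * g s

/-- The Picard-Fuchs operator `θ² - α (θ + 1/r) (θ + 1 - 1/r)`. -/
def picardFuchs (r : ℕ) (g : ℂ → ℂ) (s : ℂ) : ℂ :=
  F.θadd 0 (F.θadd 0 g) s
    - F.α s * F.θadd (1 / (r : ℂ)) (F.θadd (1 - 1 / (r : ℂ)) g) s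

/-- The form `Ω_s` on the fibre over `s`, carried to the fixed torus `ℝ² / ℤ²`. -/
def Ω (s : ℂ) : PlaneOneForm := pullbackOneForm (torusMarking (F.τ s)) (constDz (F.f s))

/-- The derivative `∂_α Ω` (for the Gauss-Manin connection), computed on the fixed torus. -/
def dαΩ (s : ℂ) : PlaneOneForm := fun p => F.dα (fun u => F.Ω u p) s

/-- The Yukawa coupling `C_α = ∫ Ω ∧ ∂_α Ω`, the integral being over the fibre. -/
def yukawa (s : ℂ) : ℂ := torusIntegralWedge (F.Ω s) (F.dαΩ s)

/-- The family has the Picard-Fuchs operator `θ² - α (θ + 1/r) (θ + 1 - 1/r)`: it annihilates the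
periods of `Ω` over all the (locally constant families of) integral cycles. -/
def HasPicardFuchs (r : ℕ) : Prop :=
  ∀ m n : ℤ, ∀ s ∈ F.base, F.picardFuchs r (fun u => torusPeriod (F.Ω u) m n) s = 0

/-- The normalization at `α = 0`: the point `α = 0` is in the closure of the range of `α`, and
`α C_α` tends to `1` as `α` tends to `0`. -/
def IsNormalizedAtZero : Prop :=
  (comap F.α (𝓝 0) ⊓ 𝓟 F.base).NeBot ∧
    Tendsto (fun s => F.α s * F.yukawa s) (comap F.α (𝓝 0) ⊓ 𝓟 F.base) (𝓝 1)

/-- The family is the one of level `L`, with `Ω = c ω₀(α) dz` and `τ = ω₁(α) / ω₀(α)`, so that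
`Ω` has the periods `c ω₀(α)` and `c ω₁(α)`. The equations are required near one point, at which
both hypergeometric series converge, so that the functions on the base are the analytic
continuations. -/
def IsModularFamily (L : ModularLevel) (c : ℂ) : Prop :=
  ∃ s₀ ∈ F.base, ‖F.α s₀‖ < 1 ∧ ‖1 - F.α s₀‖ < 1 ∧
    ∀ᶠ s in 𝓝 s₀, F.f s = c * L.omega0 (F.α s) ∧ F.τ s = L.omega1 (F.α s) / L.omega0 (F.α s)

end EllipticFamily

end

/-! On the fixed torus `Ω = f dx + f τ dy`, so the Yukawa coupling is the Wronskian of the periods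
`f` and `f τ` with respect to `∂_α` (`yukawa_eq`). Divided by `α`, the Picard-Fuchs operator is the
self-adjoint `∂_α (α (1 - α) ∂_α g) - (1/r)(1 - 1/r) g` (`picardFuchs_eq`). By Abel's identity `α (1
- α)` times the Wronskian is constant on the connected base, and the normalization at `α = 0` makes
the constant `1`.

For the modular family both periods are multiples of `G(α)` and `G(1 - α)`, where `G = ₂F₁(a, 1 - a;
1; ·)` and `a = 1/r`. Near the base point they solve the equation, and the identity theorem extends
this to the whole base. The constant comes from the Wronskian of `G(z)` and `G(1 - z)`, evaluated as
`z → 0⁺` (`hyp_wronskian`): it is `sin(πa)/π`, the limit of `n` times the `n`-th coefficient of `G`.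
Since `sin(π/r) = √N / 2`, the factor `√N` cancels and `1/(2πi)` remains. -/

/-! ### Power series with bounded coefficients, and an Abelian limit -/

/-- A power series with bounded coefficients is differentiable term by term in the unit disc. -/
theorem hasDerivAt_tsum_mul_pow_of_bounded {c : ℕ → ℂ} {C : ℝ} (hc : ∀ n, ‖c n‖ ≤ C) {z : ℂ}
    (hz : ‖z‖ < 1) :
    HasDerivAt (fun w => ∑' n, c n * w ^ n) (∑' n : ℕ, ((n : ℂ) + 1) * c (n + 1) * z ^ n) z := by
  obtain ⟨ρ, hzρ, hρ⟩ := exists_between hz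
  have hρ0 : 0 < ρ := (norm_nonneg z).trans_lt hzρ
  have hu : Summable fun n : ℕ => C * ((n : ℝ) * ρ ^ (n - 1)) := by
    refine Summable.mul_left _ ?_
    have h : Summable fun n : ℕ => ((n : ℝ) ^ 1 * ρ ^ n) :=
      summable_pow_mul_geometric_of_norm_lt_one 1 (by rwa [Real.norm_of_nonneg hρ0.le])
    refine (h.mul_right ρ⁻¹).congr fun n => ?_
    rcases n with _ | n
    · simp
    · simp only [Nat.add_sub_cancel]
      field_simp
      ring
  have hbound : ∀ (n : ℕ) (y : ℂ), y ∈ Metric.ball (0 : ℂ) ρ →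
      ‖c n * ((n : ℂ) * y ^ (n - 1))‖ ≤ C * ((n : ℝ) * ρ ^ (n - 1)) := by
    intro n y hy
    rw [mem_ball_zero_iff] at hy
    rw [norm_mul, norm_mul, norm_pow, Complex.norm_natCast]
    have := (norm_nonneg _).trans (hc n)
    gcongr
    exact hc n
  have hz' : z ∈ Metric.ball (0 : ℂ) ρ := by simpa using hzρ
  have key := hasDerivAt_tsum_of_isPreconnected (g := fun n w => c n * w ^ n) hu Metric.isOpen_ball
    (convex_ball (0 : ℂ) ρ).isPreconnected (fun n y _ => (hasDerivAt_pow n y).const_mul (c n)) hbound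
    (Metric.mem_ball_self hρ0)
    (summable_of_ne_finset_zero (s := {0}) fun n hn => by
      have : n ≠ 0 := by simpa using hn
      simp [this]) hz'
  refine key.congr_deriv ?_
  rw [(Summable.of_norm_bounded hu fun n => hbound n z hz').tsum_eq_zero_add]
  simp only [Nat.cast_zero, zero_mul, mul_zero, zero_add, Nat.add_sub_cancel, Nat.cast_add,
    Nat.cast_one]
  exact tsum_congr fun n => by ring

theorem summable_mul_pow_of_bounded {c : ℕ → ℂ} {C : ℝ} (hc : ∀ n, ‖c n‖ ≤ C) {z : ℂ}
    (hz : ‖z‖ < 1) : Summable fun n => c n * z ^ n := by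
  refine Summable.of_norm_bounded
    ((summable_geometric_of_lt_one (norm_nonneg z) hz).mul_left C) fun n => ?_
  rw [norm_mul, norm_pow]
  gcongr
  exact hc n

theorem exists_norm_le_of_tendsto {b : ℕ → ℂ} {l : ℂ} (hb : Tendsto b atTop (𝓝 l)) :
    ∃ C, ∀ n, ‖b n‖ ≤ C := by
  obtain ⟨C, hC⟩ := (Metric.isBounded_range_of_tendsto b hb).exists_norm_le
  exact ⟨C, fun n => hC _ (Set.mem_range_self n)⟩

/-- Multiplication of a power series by `1 - z` takes differences of the coefficients. -/
theorem one_sub_mul_tsum_mul_pow {b : ℕ → ℂ} {C : ℝ} (hb : ∀ n, ‖b n‖ ≤ C) {z : ℂ}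
    (hz : ‖z‖ < 1) :
    (1 - z) * ∑' n, b n * z ^ n
      = ∑' n : ℕ, (b n - if n = 0 then 0 else b (n - 1)) * z ^ n := by
  have hs := summable_mul_pow_of_bounded hb hz
  have hs1 : Summable fun n => b (n + 1) * z ^ (n + 1) := (summable_nat_add_iff 1).2 hs
  have hs2 : Summable fun n : ℕ => (b n - if n = 0 then 0 else b (n - 1)) * z ^ n := by
    refine (summable_nat_add_iff 1).1 ((hs1.sub (hs.mul_left z)).congr fun n => ?_)
    simp
    ring
  rw [hs2.tsum_eq_zero_add, sub_mul, one_mul]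
  nth_rw 1 [hs.tsum_eq_zero_add]
  rw [← tsum_mul_left, add_sub_assoc, ← hs1.tsum_sub (hs.mul_left z)]
  congr 1
  · simp
  · exact tsum_congr fun n => by simp; ring

/-- If the coefficients of a power series tend to `l`, then `(1 - x)` times its sum tends to `l`
as `x` tends to `1` from below. -/
theorem tendsto_one_sub_mul_tsum_mul_pow {b : ℕ → ℂ} {l : ℂ} (hb : Tendsto b atTop (𝓝 l)) :
    Tendsto (fun x : ℝ => (1 - (x : ℂ)) * ∑' n, b n * (x : ℂ) ^ n) (𝓝[<] 1) (𝓝 l) := by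
  obtain ⟨C, hC⟩ := exists_norm_le_of_tendsto hb
  have hsum : ∀ n, ∑ i ∈ Finset.range (n + 1), (b i - if i = 0 then 0 else b (i - 1)) = b n := by
    intro n
    induction n with
    | zero => simp
    | succ n ih => rw [Finset.sum_range_succ, ih]; simp
  -- Abel's limit theorem for the series of differences, whose partial sums telescope to `b n`.
  have h := Complex.tendsto_tsum_powerSeries_nhdsWithin_lt
    (f := fun i : ℕ => b i - if i = 0 then 0 else b (i - 1)) (l := l)
    ((tendsto_add_atTop_iff_nat 1).1 (by simpa only [hsum] using hb))
  rw [tendsto_map'_iff] at h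
  refine h.congr' ?_
  filter_upwards [Ioo_mem_nhdsLT (show (0 : ℝ) < 1 by norm_num)] with x hx
  refine (one_sub_mul_tsum_mul_pow hC ?_).symm
  rw [Complex.norm_real, Real.norm_of_nonneg hx.1.le]
  exact hx.2

/-! ### The hypergeometric function `₂F₁(a, 1 - a; 1; z)` -/

/-- The coefficients of `₂F₁(a, 1 - a; 1; z)`. -/
noncomputable def hypCoeff (a : ℂ) (n : ℕ) : ℂ := ordinaryHypergeometricCoefficient a (1 - a) 1 n

theorem hypCoeff_zero (a : ℂ) : hypCoeff a 0 = 1 := by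
  simp [hypCoeff, ordinaryHypergeometricCoefficient]

theorem hypCoeff_succ (a : ℂ) (n : ℕ) :
    ((n : ℂ) + 1) ^ 2 * hypCoeff a (n + 1) = (a + n) * (1 - a + n) * hypCoeff a n := by
  have h1 : (n : ℂ) + 1 ≠ 0 := Nat.cast_add_one_ne_zero n
  have h2 : (n.factorial : ℂ) ≠ 0 := by exact_mod_cast n.factorial_ne_zero
  simp only [hypCoeff, ordinaryHypergeometricCoefficient, ascPochhammer_succ_eval,
    ascPochhammer_eval_one, Nat.factorial_succ, Nat.cast_mul, Nat.cast_add, Nat.cast_one]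
  have h3 : (1 : ℂ) + n ≠ 0 := by rwa [add_comm]
  field_simp
  ring

theorem ordinaryHypergeometric_eq_tsum_hypCoeff (a z : ℂ) :
    ordinaryHypergeometric a (1 - a) 1 z = ∑' n, hypCoeff a n * z ^ n := by
  rw [ordinaryHypergeometric_eq_tsum]
  rfl

/-- The products over `range (n + 1)` are the denominators of `Complex.GammaSeq` at `a` and `1 - a`.
-/
theorem succ_mul_hypCoeff_succ (a : ℂ) (n : ℕ) :
    ((n : ℂ) + 1) * hypCoeff a (n + 1) = (∏ j ∈ Finset.range (n + 1), (a + j)) *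
      (∏ j ∈ Finset.range (n + 1), (1 - a + j)) / ((n.factorial : ℂ) ^ 2 * (n + 1)) := by
  induction n with
  | zero =>
    have := hypCoeff_succ a 0
    simp [hypCoeff_zero] at this
    simp [this]
  | succ n ih =>
    have h1 : (n : ℂ) + 1 ≠ 0 := Nat.cast_add_one_ne_zero n
    have h3 : (n : ℂ) + 1 + 1 ≠ 0 := by exact_mod_cast Nat.cast_add_one_ne_zero (R := ℂ) (n + 1)
    have h2 : (n.factorial : ℂ) ≠ 0 := by exact_mod_cast n.factorial_ne_zero
    have := hypCoeff_succ a (n + 1)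
    rw [Finset.prod_range_succ _ (n + 1), Finset.prod_range_succ _ (n + 1), Nat.factorial_succ]
    push_cast at this ⊢
    rw [eq_div_iff (by positivity)] at ih ⊢
    linear_combination (n + 1 : ℂ) ^ 2 * (n.factorial : ℂ) ^ 2 * this
      + (a + (n + 1)) * (1 - a + (n + 1)) * ih

/-- Euler's limit for `Γ(a) Γ(1 - a)`, inverted, combined with the reflection formula. -/
theorem tendsto_succ_mul_hypCoeff_succ {a : ℂ} (ha : Complex.sin (Real.pi * a) ≠ 0) :
    Tendsto (fun n : ℕ => ((n : ℂ) + 1) * hypCoeff a (n + 1)) atTop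
      (𝓝 (Complex.sin (Real.pi * a) / Real.pi)) := by
  have h := ((Complex.GammaSeq_tendsto_Gamma a).mul (Complex.GammaSeq_tendsto_Gamma (1 - a)))
  rw [Complex.Gamma_mul_Gamma_one_sub] at h
  have hpi : (Real.pi : ℂ) ≠ 0 := by exact_mod_cast Real.pi_ne_zero
  -- The two `GammaSeq` factors contribute `n ^ a * n ^ (1 - a) = n`; the factor `n / (n + 1)`
  -- replaces this `n` by the required `n + 1`.
  have h' := (h.inv₀ (div_ne_zero hpi ha)).mul (tendsto_natCast_div_add_atTop (𝕜 := ℂ) 1)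
  rw [inv_div, mul_one] at h'
  refine h'.congr' ?_
  filter_upwards [eventually_ne_atTop 0] with n hn
  have hn' : (n : ℂ) ≠ 0 := Nat.cast_ne_zero.2 hn
  have h2 : (n.factorial : ℂ) ≠ 0 := by exact_mod_cast n.factorial_ne_zero
  have hpow : (n : ℂ) ^ a * (n : ℂ) ^ (1 - a) = n := by
    rw [← Complex.cpow_add _ _ hn']; simp
  rw [succ_mul_hypCoeff_succ, Complex.GammaSeq, Complex.GammaSeq, div_mul_div_comm, inv_div,
    mul_mul_mul_comm, hpow, div_mul_div_comm]
  have h1 : (n : ℂ) + 1 ≠ 0 := Nat.cast_add_one_ne_zero n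
  field_simp

theorem tendsto_hypCoeff {a : ℂ} (ha : Complex.sin (Real.pi * a) ≠ 0) :
    Tendsto (hypCoeff a) atTop (𝓝 0) := by
  refine (tendsto_add_atTop_iff_nat 1).1 ?_
  have h := (tendsto_succ_mul_hypCoeff_succ ha).mul
    (tendsto_one_div_add_atTop_nhds_zero_nat (𝕜 := ℂ))
  rw [mul_zero] at h
  refine h.congr fun n => ?_
  have h1 : (n : ℂ) + 1 ≠ 0 := Nat.cast_add_one_ne_zero n
  field_simp

/-- The sum of the termwise derivative of the series `₂F₁(a, 1 - a; 1; z)`. -/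
noncomputable def hypDeriv (a z : ℂ) : ℂ := ∑' n : ℕ, ((n : ℂ) + 1) * hypCoeff a (n + 1) * z ^ n

theorem hasDerivAt_hyp {a : ℂ} (ha : Complex.sin (Real.pi * a) ≠ 0) {z : ℂ} (hz : ‖z‖ < 1) :
    HasDerivAt (ordinaryHypergeometric a (1 - a) 1) (hypDeriv a z) z := by
  obtain ⟨C, hC⟩ := exists_norm_le_of_tendsto (tendsto_hypCoeff ha)
  rw [funext (ordinaryHypergeometric_eq_tsum_hypCoeff a)]
  exact hasDerivAt_tsum_mul_pow_of_bounded hC hz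

/-- The hypergeometric equation, in self-adjoint form. -/
theorem hasDerivAt_mul_one_sub_mul_hypDeriv {a : ℂ} (ha : Complex.sin (Real.pi * a) ≠ 0) {z : ℂ}
    (hz : ‖z‖ < 1) :
    HasDerivAt (fun w => w * (1 - w) * hypDeriv a w)
      (a * (1 - a) * ordinaryHypergeometric a (1 - a) 1 z) z := by
  obtain ⟨C, hC⟩ := exists_norm_le_of_tendsto (tendsto_succ_mul_hypCoeff_succ ha)
  have hC' : ∀ n, ‖((n : ℕ) : ℂ) * hypCoeff a n‖ ≤ C := by
    rintro (_ | n)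
    · simpa using (norm_nonneg _).trans (hC 0)
    · simpa using hC n
  have hd : ∀ n : ℕ, ‖(n : ℂ) * hypCoeff a n
      - if n = 0 then 0 else ((n - 1 : ℕ) : ℂ) * hypCoeff a (n - 1)‖ ≤ C + C := by
    intro n
    refine (norm_sub_le _ _).trans (add_le_add (hC' n) ?_)
    split_ifs
    · simpa using (norm_nonneg _).trans (hC 0)
    · exact hC' _
  -- With `c = hypCoeff a`, the function is `(1 - w) ∑ n c_n w^n`, with coefficients `n c_n - (n -
  -- 1) c_{n-1}`. Its derivative has coefficients `(n + 1)² c_{n+1} - n (n + 1) c_n = a (1 - a)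
  -- c_n`, by the recurrence.
  have h := hasDerivAt_tsum_mul_pow_of_bounded hd hz
  have hev : ∀ᶠ w : ℂ in 𝓝 z, ‖w‖ < 1 := continuous_norm.continuousAt.eventually_lt_const hz
  refine (h.congr_deriv ?_).congr_of_eventuallyEq ?_
  · rw [ordinaryHypergeometric_eq_tsum_hypCoeff, ← tsum_mul_left]
    refine tsum_congr fun n => ?_
    have := hypCoeff_succ a n
    simp only [Nat.add_eq_zero_iff, one_ne_zero, and_false, if_false, Nat.add_sub_cancel]
    push_cast
    linear_combination z ^ n * this
  · filter_upwards [hev] with w hw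
    rw [← one_sub_mul_tsum_mul_pow hC' hw,
      (summable_mul_pow_of_bounded hC' hw).tsum_eq_zero_add, hypDeriv, mul_comm w, mul_assoc,
      ← tsum_mul_left]
    simp only [Nat.cast_zero, zero_mul, zero_add, Nat.cast_add, Nat.cast_one]
    congr 1
    exact tsum_congr fun n => by ring

theorem hyp_apply_zero (a : ℂ) : ordinaryHypergeometric a (1 - a) 1 (0 : ℂ) = 1 :=
  ordinaryHypergeometric_zero _ _ _

theorem tendsto_one_sub_nhdsGT_zero : Tendsto (fun x : ℝ => 1 - x) (𝓝[>] 0) (𝓝[<] 1) := by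
  refine tendsto_nhdsWithin_iff.2 ⟨?_, ?_⟩
  · have : Tendsto (fun x : ℝ => 1 - x) (𝓝 0) (𝓝 (1 - 0)) := by
      exact (continuous_const.sub continuous_id).tendsto 0
    rw [sub_zero] at this
    exact this.mono_left nhdsWithin_le_nhds
  · filter_upwards [self_mem_nhdsWithin] with x hx
    simpa using hx

/-- The Wronskian of `₂F₁(a, 1 - a; 1; z)` and `₂F₁(a, 1 - a; 1; 1 - z)`. -/
theorem hyp_wronskian {a : ℂ} (ha : Complex.sin (Real.pi * a) ≠ 0) {z : ℂ} (hz : ‖z‖ < 1)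
    (hz' : ‖1 - z‖ < 1) :
    z * (1 - z) * (ordinaryHypergeometric a (1 - a) 1 z * hypDeriv a (1 - z)
      + ordinaryHypergeometric a (1 - a) 1 (1 - z) * hypDeriv a z)
      = Complex.sin (Real.pi * a) / Real.pi := by
  set G : ℂ → ℂ := ordinaryHypergeometric a (1 - a) 1 with hG
  set w : ℂ → ℂ := fun z => G z * ((1 - z) * (1 - (1 - z)) * hypDeriv a (1 - z))
    + G (1 - z) * (z * (1 - z) * hypDeriv a z) with hw
  -- In the derivative of `w` the terms `G G` cancel by self-adjointness, and so do the terms in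
  -- `hypDeriv a z * hypDeriv a (1 - z)`.
  have hderiv : ∀ z : ℂ, ‖z‖ < 1 → ‖1 - z‖ < 1 → HasDerivAt w 0 z := by
    intro z hz hz'
    have hs : HasDerivAt (fun z : ℂ => 1 - z) (-1) z := (hasDerivAt_id z).const_sub 1
    have h1 := hasDerivAt_hyp ha hz
    have h2 := (hasDerivAt_hyp ha hz').comp z hs
    have h3 := hasDerivAt_mul_one_sub_mul_hypDeriv ha hz
    have h4 := (hasDerivAt_mul_one_sub_mul_hypDeriv ha hz').comp z hs
    refine ((h1.mul h4).add (h2.mul h3)).congr_deriv ?_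
    simp only [Function.comp_apply]
    ring
  set S : Set ℂ := Metric.ball 0 1 ∩ Metric.ball 1 1 with hS
  have memS : ∀ z, z ∈ S ↔ ‖z‖ < 1 ∧ ‖1 - z‖ < 1 := by
    intro z
    simp [hS, dist_eq_norm, norm_sub_rev]
  have hconst : ∀ x ∈ S, ∀ y ∈ S, w x = w y := by
    intro x hx y hy
    refine (Metric.isOpen_ball.inter Metric.isOpen_ball).is_const_of_deriv_eq_zero
      ((convex_ball (0 : ℂ) 1).inter (convex_ball 1 1)).isPreconnected (fun z h => ?_)
      (fun z h => ?_) hx hy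
    · exact (hderiv z ((memS z).1 h).1 ((memS z).1 h).2).differentiableAt.differentiableWithinAt
    · exact (hderiv z ((memS z).1 h).1 ((memS z).1 h).2).deriv
  have hcast : Tendsto (fun x : ℝ => (x : ℂ)) (𝓝[>] 0) (𝓝 0) := by
    have := Complex.continuous_ofReal.tendsto 0
    rw [Complex.ofReal_zero] at this
    exact this.mono_left nhdsWithin_le_nhds
  have hG0 : Tendsto (fun x : ℝ => G x) (𝓝[>] 0) (𝓝 1) := by
    have := ((hasDerivAt_hyp ha (z := 0) (by simp)).continuousAt.tendsto).comp hcast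
    rwa [hyp_apply_zero] at this
  have hD0 : Tendsto (fun x : ℝ => (1 - (x : ℂ)) * hypDeriv a x) (𝓝[>] 0)
      (𝓝 ((1 - 0) * hypDeriv a 0)) := by
    obtain ⟨C, hC⟩ := exists_norm_le_of_tendsto (tendsto_succ_mul_hypCoeff_succ ha)
    have := (hasDerivAt_tsum_mul_pow_of_bounded hC (z := 0) (by simp)).continuousAt
    exact (tendsto_const_nhds.sub hcast).mul (this.tendsto.comp hcast)
  -- As `x → 0⁺`, `x * hypDeriv a (1 - x)` tends to `sin(πa)/π`, while `x * G (1 - x)` tends to `0`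
  -- because the coefficients of `G` do.
  have hA := (tendsto_one_sub_mul_tsum_mul_pow (tendsto_succ_mul_hypCoeff_succ ha)).comp
    tendsto_one_sub_nhdsGT_zero
  have hB := (tendsto_one_sub_mul_tsum_mul_pow (tendsto_hypCoeff ha)).comp
    tendsto_one_sub_nhdsGT_zero
  have hlim : Tendsto (fun x : ℝ => w x) (𝓝[>] 0) (𝓝 (Complex.sin (Real.pi * a) / Real.pi)) := by
    have := (hG0.mul ((tendsto_const_nhds (x := (1 : ℂ))).sub hcast |>.mul hA)).add (hB.mul hD0)
    simp only [sub_zero, one_mul, zero_mul, add_zero] at this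
    refine this.congr fun x => ?_
    simp only [hw, hG, Function.comp_apply, Complex.ofReal_sub, Complex.ofReal_one,
      ordinaryHypergeometric_eq_tsum_hypCoeff a (1 - x)]
    simp only [hypDeriv]
    ring
  have hzS : z ∈ S := (memS z).2 ⟨hz, hz'⟩
  have hev : ∀ᶠ x : ℝ in 𝓝[>] 0, w x = w z := by
    filter_upwards [Ioo_mem_nhdsGT (show (0 : ℝ) < 1 by norm_num)] with x hx
    refine hconst _ ((memS _).2 ⟨?_, ?_⟩) _ hzS
    · rw [Complex.norm_real, Real.norm_of_nonneg hx.1.le]; exact hx.2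
    · rw [← Complex.ofReal_one, ← Complex.ofReal_sub, Complex.norm_real, Real.norm_of_nonneg]
      · linarith [hx.1]
      · linarith [hx.2]
  rw [tendsto_nhds_unique (hlim.congr' hev) tendsto_const_nhds]
  simp only [hw]
  ring

/-! ### Periods, the Yukawa coupling and the calculus of `∂_α` -/

namespace EllipticFamily

variable (F : EllipticFamily)

/-- The real linear form `dx` on the plane, with complex values. -/
noncomputable def dxForm : ℝ × ℝ →L[ℝ] ℂ := Complex.ofRealCLM.comp (ContinuousLinearMap.fst ℝ ℝ ℝ)

/-- The real linear form `dy` on the plane, with complex values. -/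
noncomputable def dyForm : ℝ × ℝ →L[ℝ] ℂ := Complex.ofRealCLM.comp (ContinuousLinearMap.snd ℝ ℝ ℝ)

theorem hasFDerivAt_torusMarking (τ : ℂ) (p : ℝ × ℝ) :
    HasFDerivAt (torusMarking τ) (dxForm + τ • dyForm) p := by
  have h : torusMarking τ = ⇑(dxForm + τ • dyForm) := by
    ext q
    simp [torusMarking, dxForm, dyForm, mul_comm]
  rw [h]
  exact ContinuousLinearMap.hasFDerivAt _

theorem Ω_eq (s : ℂ) (p : ℝ × ℝ) : F.Ω s p = F.f s • dxForm + (F.f s * F.τ s) • dyForm := by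
  ext <;>
  simp [Ω, pullbackOneForm, constDz, (hasFDerivAt_torusMarking _ p).fderiv, dxForm, dyForm]

theorem torusPeriod_Ω (s : ℂ) (m n : ℤ) :
    torusPeriod (F.Ω s) m n = m * F.f s + n * (F.f s * F.τ s) := by
  simp [torusPeriod, Ω_eq, dxForm, dyForm, mul_comm]

variable {F}

theorem differentiableAt_of_mem {g : ℂ → ℂ} (hg : DifferentiableOn ℂ g F.base) {s : ℂ}
    (hs : s ∈ F.base) : DifferentiableAt ℂ g s :=
  hg.differentiableAt (F.isOpen_base.mem_nhds hs)

variable (F)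

theorem differentiableOn_period : DifferentiableOn ℂ (fun u => F.f u * F.τ u) F.base :=
  F.differentiableOn_f.mul F.differentiableOn_τ

theorem dαΩ_eq {s : ℂ} (hs : s ∈ F.base) (p : ℝ × ℝ) :
    F.dαΩ s p = F.dα F.f s • dxForm + F.dα (fun u => F.f u * F.τ u) s • dyForm := by
  have h1 := (differentiableAt_of_mem F.differentiableOn_f hs).hasDerivAt.smul_const dxForm
  have h2 := (differentiableAt_of_mem F.differentiableOn_period hs).hasDerivAt.smul_const dyForm
  have h : deriv (fun u => F.Ω u p) s = deriv F.f s • dxForm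
      + deriv (fun u => F.f u * F.τ u) s • dyForm := by
    simp only [Ω_eq]
    exact (h1.add h2).deriv
  rw [dαΩ, dα, h, smul_add, smul_smul, smul_smul]
  rfl

/-- The Yukawa coupling is the Wronskian of the two basic periods. -/
theorem yukawa_eq {s : ℂ} (hs : s ∈ F.base) :
    F.yukawa s = F.f s * F.dα (fun u => F.f u * F.τ u) s - F.f s * F.τ s * F.dα F.f s := by
  simp [yukawa, torusIntegralWedge, wedgeCoeff, Ω_eq, dαΩ_eq F hs, dxForm, dyForm]

theorem differentiableOn_dα {g : ℂ → ℂ} (hg : DifferentiableOn ℂ g F.base) :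
    DifferentiableOn ℂ (F.dα g) F.base :=
  ((F.differentiableOn_α.deriv F.isOpen_base).inv F.deriv_α_ne_zero).smul
    (hg.deriv F.isOpen_base)

theorem dα_α {s : ℂ} (hs : s ∈ F.base) : F.dα F.α s = 1 := by
  simp [dα, F.deriv_α_ne_zero s hs]

variable {F} in
theorem dα_congr {g h : ℂ → ℂ} {s : ℂ} (hgh : g =ᶠ[𝓝 s] h) : F.dα g s = F.dα h s := by
  rw [dα, dα, hgh.deriv_eq]

theorem dα_add {g h : ℂ → ℂ} (hg : DifferentiableOn ℂ g F.base)
    (hh : DifferentiableOn ℂ h F.base) {s : ℂ} (hs : s ∈ F.base) :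
    F.dα (fun u => g u + h u) s = F.dα g s + F.dα h s := by
  rw [dα, deriv_fun_add (differentiableAt_of_mem hg hs) (differentiableAt_of_mem hh hs), smul_add]
  rfl

theorem dα_const_mul (c : ℂ) {g : ℂ → ℂ} (hg : DifferentiableOn ℂ g F.base) {s : ℂ}
    (hs : s ∈ F.base) : F.dα (fun u => c * g u) s = c * F.dα g s := by
  simp only [dα, deriv_const_mul c (differentiableAt_of_mem hg hs), smul_eq_mul]
  ring

theorem dα_mul {g h : ℂ → ℂ} (hg : DifferentiableOn ℂ g F.base)
    (hh : DifferentiableOn ℂ h F.base) {s : ℂ} (hs : s ∈ F.base) :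
    F.dα (fun u => g u * h u) s = F.dα g s * h s + g s * F.dα h s := by
  simp only [dα, deriv_fun_mul (differentiableAt_of_mem hg hs) (differentiableAt_of_mem hh hs),
    smul_eq_mul]
  ring

variable {F} in
theorem dα_comp {G : ℂ → ℂ} {G' s : ℂ} (hs : s ∈ F.base) (hG : HasDerivAt G G' (F.α s)) :
    F.dα (fun u => G (F.α u)) s = G' := by
  have h := hG.comp s (differentiableAt_of_mem F.differentiableOn_α hs).hasDerivAt
  have h' : deriv (fun u => G (F.α u)) s = G' * deriv F.α s := h.deriv
  have := F.deriv_α_ne_zero s hs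
  rw [dα, h', smul_eq_mul]
  field_simp

theorem dα_θadd (c : ℂ) {g : ℂ → ℂ} (hg : DifferentiableOn ℂ g F.base) {s : ℂ}
    (hs : s ∈ F.base) :
    F.dα (F.θadd c g) s = F.dα g s + F.α s * F.dα (F.dα g) s + c * F.dα g s := by
  have hd := F.differentiableOn_dα hg
  have : F.θadd c g = fun u => F.α u * F.dα g u + c * g u := rfl
  rw [this, F.dα_add (F.differentiableOn_α.fun_mul hd) (hg.const_mul c) hs,
    F.dα_mul F.differentiableOn_α hd hs, F.dα_const_mul c hg hs, F.dα_α hs, one_mul]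

/-! ### The self-adjoint Picard-Fuchs equation and constancy of the Wronskian -/

/-- The function `α (1 - α) ∂_α g`. -/
noncomputable def flux (g : ℂ → ℂ) (s : ℂ) : ℂ := F.α s * (1 - F.α s) * F.dα g s

theorem differentiableOn_flux {g : ℂ → ℂ} (hg : DifferentiableOn ℂ g F.base) :
    DifferentiableOn ℂ (F.flux g) F.base :=
  (F.differentiableOn_α.mul (F.differentiableOn_α.const_sub 1)).mul (F.differentiableOn_dα hg)

theorem dα_flux {g : ℂ → ℂ} (hg : DifferentiableOn ℂ g F.base) {s : ℂ} (hs : s ∈ F.base) :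
    F.dα (F.flux g) s
      = (1 - 2 * F.α s) * F.dα g s + F.α s * (1 - F.α s) * F.dα (F.dα g) s := by
  have hα := F.differentiableOn_α
  have h : F.dα (fun u => F.α u * (1 - F.α u)) s = 1 - 2 * F.α s := by
    refine dα_comp (G := fun z => z * (1 - z)) hs ?_
    refine ((hasDerivAt_id (F.α s)).mul ((hasDerivAt_id (F.α s)).const_sub 1)).congr_deriv ?_
    simp only [id]
    ring
  have : F.flux g = fun u => F.α u * (1 - F.α u) * F.dα g u := rfl
  rw [this, F.dα_mul (hα.fun_mul (hα.const_sub 1)) (F.differentiableOn_dα hg) hs, h]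

/-- The Picard-Fuchs operator in self-adjoint form. -/
theorem picardFuchs_eq (r : ℕ) {g : ℂ → ℂ} (hg : DifferentiableOn ℂ g F.base) {s : ℂ}
    (hs : s ∈ F.base) :
    F.picardFuchs r g s
      = F.α s * (F.dα (F.flux g) s - 1 / (r : ℂ) * (1 - 1 / (r : ℂ)) * g s) := by
  rw [picardFuchs, F.dα_flux hg hs, θadd, F.dα_θadd 0 hg hs, θadd.eq_1 F (1 / (r : ℂ)),
    F.dα_θadd _ hg hs, θadd, θadd]
  ring

theorem differentiableOn_picardFuchs (r : ℕ) {g : ℂ → ℂ} (hg : DifferentiableOn ℂ g F.base) :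
    DifferentiableOn ℂ (F.picardFuchs r g) F.base := by
  refine DifferentiableOn.congr (f := fun s =>
    F.α s * (F.dα (F.flux g) s - 1 / (r : ℂ) * (1 - 1 / (r : ℂ)) * g s)) ?_
    fun s hs => F.picardFuchs_eq r hg hs
  exact F.differentiableOn_α.mul
    ((F.differentiableOn_dα (F.differentiableOn_flux hg)).sub (hg.const_mul _))

theorem α_mul_one_sub_ne_zero {s : ℂ} (hs : s ∈ F.base) : F.α s * (1 - F.α s) ≠ 0 :=
  mul_ne_zero (F.α_ne_zero s hs) (sub_ne_zero.2 (F.α_ne_one s hs).symm)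

variable {F}

/-- The cycles `(1, 0)` and `(0, 1)` have periods `f` and `f τ`; the factor `α` of the operator is
nonzero and is removed. -/
theorem HasPicardFuchs.dα_flux_eq {r : ℕ} (h : F.HasPicardFuchs r) {s : ℂ} (hs : s ∈ F.base) :
    F.dα (F.flux F.f) s = 1 / (r : ℂ) * (1 - 1 / (r : ℂ)) * F.f s ∧
    F.dα (F.flux fun u => F.f u * F.τ u) s
      = 1 / (r : ℂ) * (1 - 1 / (r : ℂ)) * (F.f s * F.τ s) := by
  have h1 := h 1 0 s hs
  have h2 := h 0 1 s hs
  simp only [torusPeriod_Ω, Int.cast_one, Int.cast_zero, one_mul, zero_mul, add_zero,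
    zero_add] at h1 h2
  rw [F.picardFuchs_eq r F.differentiableOn_f hs] at h1
  rw [F.picardFuchs_eq r F.differentiableOn_period hs] at h2
  exact ⟨sub_eq_zero.1 ((mul_eq_zero.1 h1).resolve_left (F.α_ne_zero s hs)),
    sub_eq_zero.1 ((mul_eq_zero.1 h2).resolve_left (F.α_ne_zero s hs))⟩

/-- The Picard-Fuchs equation determines the Yukawa coupling up to a constant. -/
theorem HasPicardFuchs.exists_yukawa_eq {r : ℕ} (h : F.HasPicardFuchs r) :
    ∃ c : ℂ, ∀ s ∈ F.base, F.yukawa s = c / (F.α s * (1 - F.α s)) := by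
  have hf := F.differentiableOn_f
  have hg := F.differentiableOn_period
  have hF := F.differentiableOn_flux hf
  have hG := F.differentiableOn_flux hg
  -- `W` is `α (1 - α)` times the Yukawa coupling.
  set W : ℂ → ℂ := fun s => F.f s * F.flux (fun u => F.f u * F.τ u) s
    + (-1) * (F.f s * F.τ s * F.flux F.f s) with hW
  have hWd : DifferentiableOn ℂ W F.base := (hf.fun_mul hG).add ((hg.fun_mul hF).const_mul (-1))
  have hder : F.base.EqOn (deriv W) 0 := by
    intro s hs
    have : F.dα W s = 0 := by
      rw [hW, F.dα_add (hf.fun_mul hG) ((hg.fun_mul hF).const_mul (-1)) hs, F.dα_mul hf hG hs,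
        F.dα_const_mul (-1) (hg.fun_mul hF) hs, F.dα_mul hg hF hs, (h.dα_flux_eq hs).1,
        (h.dα_flux_eq hs).2, flux, flux]
      ring
    exact (smul_eq_zero.1 this).resolve_left (inv_ne_zero (F.deriv_α_ne_zero s hs))
  obtain ⟨c, hc⟩ := F.isOpen_base.exists_is_const_of_deriv_eq_zero
    F.isConnected_base.isPreconnected hWd hder
  refine ⟨c, fun s hs => ?_⟩
  rw [eq_div_iff (F.α_mul_one_sub_ne_zero hs), ← hc s hs, F.yukawa_eq hs, hW]
  simp only [flux]
  ring

/-- On the base `α C_α (1 - α)` equals `c`, and it tends to `1`; the filter is nontrivial, so limits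
are unique. -/
theorem IsNormalizedAtZero.const_eq_one (h : F.IsNormalizedAtZero) {c : ℂ}
    (hc : ∀ s ∈ F.base, F.yukawa s = c / (F.α s * (1 - F.α s))) : c = 1 := by
  have := h.1
  have hα : Tendsto F.α (comap F.α (𝓝 0) ⊓ 𝓟 F.base) (𝓝 0) :=
    tendsto_comap.mono_left inf_le_left
  have h1 := h.2.mul (hα.const_sub 1)
  rw [sub_zero, mul_one] at h1
  refine tendsto_nhds_unique (tendsto_const_nhds.congr' ?_) h1
  filter_upwards [mem_inf_of_right (mem_principal_self F.base)] with s hs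
  have h0 := F.α_mul_one_sub_ne_zero hs
  rw [hc s hs]
  have h2 := left_ne_zero_of_mul h0
  have h3 := right_ne_zero_of_mul h0
  field_simp

end EllipticFamily

/-! ### The modular families and their constant -/

theorem ModularLevel.sin_pi_div_r (L : ModularLevel) :
    Complex.sin (Real.pi * (1 / (L.r : ℂ))) = ((Real.sqrt L.N : ℝ) : ℂ) / 2 := by
  have h : Real.sin (Real.pi / L.r) = Real.sqrt L.N / 2 := by
    cases L
    · simp [ModularLevel.r, ModularLevel.N]
    · simp [ModularLevel.r, ModularLevel.N]
    · simp [ModularLevel.r, ModularLevel.N]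
    · simp [ModularLevel.r, ModularLevel.N, show (4 : ℝ) = 2 ^ 2 by norm_num]
  rw [mul_one_div]
  exact_mod_cast congrArg Complex.ofReal h

theorem ModularLevel.sqrt_N_ne_zero (L : ModularLevel) : ((Real.sqrt L.N : ℝ) : ℂ) ≠ 0 := by
  have : 0 < L.N := by cases L <;> simp [ModularLevel.N]
  exact_mod_cast (Real.sqrt_pos.2 (Nat.cast_pos.2 this)).ne'

theorem ModularLevel.sin_ne_zero (L : ModularLevel) :
    Complex.sin (Real.pi * (1 / (L.r : ℂ))) ≠ 0 := by
  rw [L.sin_pi_div_r]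
  exact div_ne_zero L.sqrt_N_ne_zero two_ne_zero

namespace EllipticFamily

variable {F : EllipticFamily}

/-- Near a point where both hypergeometric series converge, the function `A F(α) + B F(1 - α)`
has the expected `∂_α` and satisfies the Picard-Fuchs equation. -/
theorem dα_and_dα_flux_of_eventuallyEq {a : ℂ} (ha : Complex.sin (Real.pi * a) ≠ 0) {s : ℂ}
    (hs : s ∈ F.base) (h0 : ‖F.α s‖ < 1) (h1 : ‖1 - F.α s‖ < 1) {g : ℂ → ℂ} {A B : ℂ}
    (hg : ∀ᶠ u in 𝓝 s, g u = A * ordinaryHypergeometric a (1 - a) 1 (F.α u)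
      + B * ordinaryHypergeometric a (1 - a) 1 (1 - F.α u)) :
    F.dα g s = A * hypDeriv a (F.α s) - B * hypDeriv a (1 - F.α s) ∧
    F.dα (F.flux g) s = a * (1 - a) * g s := by
  have hα : ContinuousAt F.α s := (differentiableAt_of_mem F.differentiableOn_α hs).continuousAt
  -- Proved at all such `t`, not only at `s`: differentiating the flux needs the formula for `∂_α g`
  -- on a neighbourhood of `s`.
  have hd : ∀ t ∈ F.base, ‖F.α t‖ < 1 → ‖1 - F.α t‖ < 1 →
      (∀ᶠ u in 𝓝 t, g u = A * ordinaryHypergeometric a (1 - a) 1 (F.α u)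
        + B * ordinaryHypergeometric a (1 - a) 1 (1 - F.α u)) →
      F.dα g t = A * hypDeriv a (F.α t) - B * hypDeriv a (1 - F.α t) := by
    intro t ht h0 h1 hg
    rw [dα_congr hg]
    refine dα_comp (G := fun z => A * ordinaryHypergeometric a (1 - a) 1 z
      + B * ordinaryHypergeometric a (1 - a) 1 (1 - z)) ht ?_
    refine (((hasDerivAt_hyp ha h0).const_mul A).add
      (((hasDerivAt_hyp ha h1).comp (F.α t)
        ((hasDerivAt_id (F.α t)).const_sub 1)).const_mul B)).congr_deriv ?_
    ring
  refine ⟨hd s hs h0 h1 hg, ?_⟩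
  have hev : ∀ᶠ u in 𝓝 s, F.flux g u = A * (F.α u * (1 - F.α u) * hypDeriv a (F.α u))
      - B * ((1 - F.α u) * (1 - (1 - F.α u)) * hypDeriv a (1 - F.α u)) := by
    filter_upwards [hg.eventually_nhds, F.isOpen_base.mem_nhds hs,
      hα.norm.eventually_lt_const h0, (hα.const_sub 1).norm.eventually_lt_const h1]
      with u h2 h3 h4 h5
    rw [flux, hd u h3 h4 h5 h2]
    ring
  rw [dα_congr hev, hg.self_of_nhds]
  refine dα_comp (G := fun z => A * (z * (1 - z) * hypDeriv a z)
      - B * ((1 - z) * (1 - (1 - z)) * hypDeriv a (1 - z))) hs ?_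
  refine (((hasDerivAt_mul_one_sub_mul_hypDeriv ha h0).const_mul A).sub
      (((hasDerivAt_mul_one_sub_mul_hypDeriv ha h1).comp (F.α s)
        ((hasDerivAt_id (F.α s)).const_sub 1)).const_mul B)).congr_deriv ?_
  ring

theorem IsModularFamily.eventually_periods {L : ModularLevel} {c s₀ : ℂ} (hs₀ : s₀ ∈ F.base)
    (h : ∀ᶠ s in 𝓝 s₀,
      F.f s = c * L.omega0 (F.α s) ∧ F.τ s = L.omega1 (F.α s) / L.omega0 (F.α s)) :
    ∀ᶠ s in 𝓝 s₀, F.f s = c * L.hyp (F.α s) ∧ F.f s * F.τ s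
      = c * (Complex.I / ((Real.sqrt L.N : ℝ) : ℂ)) * L.hyp (1 - F.α s) := by
  filter_upwards [h, F.isOpen_base.mem_nhds hs₀] with s ⟨h1, h2⟩ hs
  -- If `ω₀` vanished, division by zero would give `τ = 0`, against `0 < Im τ`.
  have h0 : L.omega0 (F.α s) ≠ 0 := by
    intro h0
    have := F.im_τ_pos s hs
    simp [h2, h0] at this
  refine ⟨h1, ?_⟩
  rw [h1, h2, mul_assoc, mul_div_cancel₀ _ h0, ModularLevel.omega1, ← mul_assoc]

/-- The equation holds near `s₀` by the hypergeometric equation; its left side is holomorphic, so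
the identity theorem carries it over the connected base. -/
theorem IsModularFamily.hasPicardFuchs {L : ModularLevel} {c : ℂ} (h : F.IsModularFamily L c) :
    F.HasPicardFuchs L.r := by
  obtain ⟨s₀, hs₀, h0, h1, hev⟩ := h
  have hev := (eventually_periods hs₀ hev).eventually_nhds
  intro m n
  have hg : DifferentiableOn ℂ (fun u => torusPeriod (F.Ω u) m n) F.base := by
    simp only [torusPeriod_Ω]
    exact (F.differentiableOn_f.const_mul _).add (F.differentiableOn_period.const_mul _)
  have hα : ContinuousAt F.α s₀ := (differentiableAt_of_mem F.differentiableOn_α hs₀).continuousAt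
  refine AnalyticOnNhd.eqOn_zero_of_preconnected_of_eventuallyEq_zero
    ((F.differentiableOn_picardFuchs L.r hg).analyticOnNhd F.isOpen_base)
    F.isConnected_base.isPreconnected hs₀ ?_
  filter_upwards [hev, F.isOpen_base.mem_nhds hs₀, hα.norm.eventually_lt_const h0,
    (hα.const_sub 1).norm.eventually_lt_const h1] with s h2 hs h3 h4
  rw [F.picardFuchs_eq L.r hg hs, (dα_and_dα_flux_of_eventuallyEq L.sin_ne_zero hs h3 h4
    (A := m * c) (B := n * (c * (Complex.I / ((Real.sqrt L.N : ℝ) : ℂ)))) ?_).2, sub_self, mul_zero]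
  · rfl
  · filter_upwards [h2] with u hu
    rw [torusPeriod_Ω, hu.2, hu.1, ModularLevel.hyp, ModularLevel.hyp]
    ring

theorem IsModularFamily.yukawa_eq {L : ModularLevel} {c : ℂ} (h : F.IsModularFamily L c) {s : ℂ}
    (hs : s ∈ F.base) :
    F.yukawa s = c ^ 2 / (2 * (Real.pi : ℂ) * Complex.I) / (F.α s * (1 - F.α s)) := by
  obtain ⟨k, hk⟩ := h.hasPicardFuchs.exists_yukawa_eq
  obtain ⟨s₀, hs₀, h0, h1, hev⟩ := h
  have hev := eventually_periods hs₀ hev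
  have hd1 := (dα_and_dα_flux_of_eventuallyEq (g := F.f) (A := c) (B := 0) L.sin_ne_zero hs₀ h0 h1
    (hev.mono fun u hu => by rw [hu.1, zero_mul, add_zero]; rfl)).1
  have hd2 := (dα_and_dα_flux_of_eventuallyEq (g := fun u => F.f u * F.τ u) (A := 0)
    (B := c * (Complex.I / ((Real.sqrt L.N : ℝ) : ℂ))) L.sin_ne_zero hs₀ h0 h1
    (hev.mono fun u hu => by rw [hu.2, zero_mul, zero_add]; rfl)).1
  have hw := hyp_wronskian L.sin_ne_zero h0 h1
  have hY := F.yukawa_eq hs₀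
  have hk₀ := (eq_div_iff (F.α_mul_one_sub_ne_zero hs₀)).1 (hk s₀ hs₀)
  rw [hd1, hd2, hev.self_of_nhds.2, hev.self_of_nhds.1, ModularLevel.hyp, ModularLevel.hyp] at hY
  rw [L.sin_pi_div_r] at hw
  have hN := L.sqrt_N_ne_zero
  have hpi : (Real.pi : ℂ) ≠ 0 := by exact_mod_cast Real.pi_ne_zero
  have hkc : k = c ^ 2 / (2 * (Real.pi : ℂ) * Complex.I) := by
    -- The sign is that of the chain rule for `1 - α`; the last factor is the hypergeometric
    -- Wronskian `sin(π/r)/π`.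
    have : k = -(c ^ 2 * (Complex.I / ((Real.sqrt L.N : ℝ) : ℂ)))
        * (((Real.sqrt L.N : ℝ) : ℂ) / 2 / Real.pi) := by
      rw [← hk₀, hY, ← hw]
      ring
    rw [this]
    field_simp
    rw [Complex.I_sq]
    ring
  rw [hk s hs, hkc]

end EllipticFamily

theorem mainTheorem8 (L : ModularLevel) (F : EllipticFamily) :
    (F.HasPicardFuchs L.r →
      (∃ c : ℂ, ∀ s ∈ F.base, F.yukawa s = c / (F.α s * (1 - F.α s))) ∧
      (F.IsNormalizedAtZero →
        ∀ s ∈ F.base, F.yukawa s = 1 / (F.α s * (1 - F.α s)))) ∧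
    (∀ c : ℂ, F.IsModularFamily L c →
      F.HasPicardFuchs L.r ∧
      (∀ s ∈ F.base, F.yukawa s =
        c ^ 2 / (2 * (Real.pi : ℂ) * Complex.I) / (F.α s * (1 - F.α s))) ∧
      (c ^ 2 = 2 * (Real.pi : ℂ) * Complex.I →
        ∀ s ∈ F.base, F.yukawa s = 1 / (F.α s * (1 - F.α s)))) := by
  refine ⟨fun h => ⟨h.exists_yukawa_eq, fun hn s hs => ?_⟩,
    fun c h => ⟨h.hasPicardFuchs, fun s hs => h.yukawa_eq hs, fun hc s hs => ?_⟩⟩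
  · obtain ⟨c, hc⟩ := h.exists_yukawa_eq
    rw [hc s hs, hn.const_eq_one hc]
  · rw [h.yukawa_eq hs, hc, div_self Complex.two_pi_I_ne_zero]
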